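/- Let $(\bar M,g,\varphi)$ be an almost Hermitian manifold, i.e. a Riemannian manifold with a smooth $(1,1)$-tensor field $\varphi$ satisfying $\varphi^2=-I$ and $g(\varphi\cdot,\varphi\cdot)=g$. Let $M$ be a submanifold of $\bar M$ given by an injective immersion, with the induced metric, again denoted $g$, and its Levi-Civita connection $\nabla$. For $X$ tangent to $M$ let $TX$ be the tangential component of $\varphi X$, and for a $(1,1)$-tensor field $S$ on $M$ put $(\nabla_XS)Y=\nabla_X(SY)-S(\nabla_XY)$. Let $k\ge 1$ and suppose that $M$ is a $k$-slant submanifold with component distributions $\mathcal D_0,\dots,\mathcal D_k$, i.e. that these are pairwise orthogonal smooth distributions of constant rank on $M$ such that * $TM=\mathcal D_0\oplus\mathcal D_1\oplus\dots\oplus\mathcal D_k$; * $T(\mathcal D_i)\subseteq\mathcal D_i$ for $i\in\{1,\dots,k\}$; * $\mathcal D_0$ is invariant, $\varphi(\mathcal D_0)\subseteq\mathcal D_0$ (possibly $\mathcal D_0=0$), and for each $i\in\{1,\dots,k\}$ the distribution $\mathcal D_i$ is nontrivial and slant with constant slant angle $\theta_i\in(0,\frac{\pi}{2}]$: for every $p\in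 M$ and every nonzero $v\in(\mathcal D_i)_p$, the angle between $\varphi v$ and the subspace $(\mathcal D_i)_p$ is $\theta_i$; moreover $\theta_i\neq\theta_j$ for $i\ne j$. Write $\Gamma(\mathcal D)$ for the smooth vector fields on $M$ with values in $\mathcal D$. Call $\mathcal D$ integrable if $[X,Y]\in\Gamma(\mathcal D)$ for all $X,Y\in\Gamma(\mathcal D)$, and completely integrable if $\nabla_XY\in\Gamma(\mathcal D)$ for all $X,Y\in\Gamma(\mathcal D)$. Then for every $i\in\{0,\dots,k\}$: (i) $\mathcal D_i$ is completely integrable if and only if $(\nabla_XT^2)Y=0$ for all $X,Y\in\Gamma(\mathcal D_i)$; (ii) $\mathcal D_i$ is integrable if and only if $(\nabla_XT^2)Y=(\nabla_YT^2)X$ for all $X,Y\in\Gamma(\mathcal D_i)$. -/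

import Mathlib

open Bundle Manifold
open scoped ContDiff

namespace KSlant

open VectorField

section LeviCivita

variable {E : Type*} [NormedAddCommGroup E] [NormedSpace ℝ E] [FiniteDimensional ℝ E]
  {H : Type*} [TopologicalSpace H] {I : ModelWithCorners ℝ E H}
  {M : Type*} [TopologicalSpace M] [ChartedSpace H M] [IsManifold I ∞ M]
  [RiemannianBundle (fun x : M => TangentSpace I x)]

/-- The Koszul expression
`X⟨Y,Z⟩ + Y⟨X,Z⟩ - Z⟨X,Y⟩ + ⟨[X,Y],Z⟩ - ⟨[X,Z],Y⟩ - ⟨[Y,Z],X⟩`, which for the Levi-Civita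
connection equals `2⟨∇_X Y, Z⟩`. -/
noncomputable def koszul (X Y Z : Π x : M, TangentSpace I x) (x : M) : ℝ :=
  d% (fun y => inner ℝ (Y y) (Z y)) x (X x)
    + d% (fun y => inner ℝ (X y) (Z y)) x (Y x)
    - d% (fun y => inner ℝ (X y) (Y y)) x (Z x)
    + inner ℝ (mlieBracket I X Y x) (Z x)
    - inner ℝ (mlieBracket I X Z x) (Y x)
    - inner ℝ (mlieBracket I Y Z x) (X x)

variable [IsContMDiffRiemannianBundle I ∞ E (fun x : M => TangentSpace I x)]

theorem mdifferentiableAt_inner {X Y : Π y : M, TangentSpace I y} {x : M}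
    (hX : MDiffAt (T% X) x) (hY : MDiffAt (T% Y) x) :
    MDiffAt (fun y => (inner ℝ (X y) (Y y) : ℝ)) x :=
  MDifferentiableAt.inner_bundle (E := fun y : M => TangentSpace I y) (F := E) hX hY

theorem koszul_tensorial_left (Y Z : Π y : M, TangentSpace I y) {x : M}
    (hY : MDiffAt (T% Y) x) (hZ : MDiffAt (T% Z) x) :
    TensorialAt I E (fun X => koszul X Y Z x) x where
  smul {f X} hf hX := by
    have : CompleteSpace E := FiniteDimensional.complete ℝ E
    simp only [koszul, Pi.smul_apply', inner_smul_left, inner_add_left, map_smul, RCLike.conj_to_real,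
      mvfderiv_fun_mul hf (mdifferentiableAt_inner hX hZ), mvfderiv_fun_mul hf (mdifferentiableAt_inner hX hY),
      mlieBracket_smul_left hf hX, smul_eq_mul, inner_smul_right]
    simp [real_inner_comm]
    ring
  add {X X'} hX hX' := by
    have : CompleteSpace E := FiniteDimensional.complete ℝ E
    simp only [koszul, Pi.add_apply, inner_add_left, map_add, inner_add_right,
      mvfderiv_fun_add (mdifferentiableAt_inner hX hZ) (mdifferentiableAt_inner hX' hZ),
      mvfderiv_fun_add (mdifferentiableAt_inner hX hY) (mdifferentiableAt_inner hX' hY),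
      mlieBracket_add_left hX hX']
    simp
    ring

theorem koszul_tensorial_right (X Y : Π y : M, TangentSpace I y) {x : M}
    (hX : MDiffAt (T% X) x) (hY : MDiffAt (T% Y) x) :
    TensorialAt I E (fun Z => koszul X Y Z x) x where
  smul {f Z} hf hZ := by
    have : CompleteSpace E := FiniteDimensional.complete ℝ E
    simp only [koszul, Pi.smul_apply', inner_smul_left, inner_add_left, map_smul, RCLike.conj_to_real,
      mvfderiv_fun_mul hf (mdifferentiableAt_inner hX hZ), mvfderiv_fun_mul hf (mdifferentiableAt_inner hY hZ),
      mlieBracket_smul_right hf hZ, smul_eq_mul, inner_smul_right]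
    simp [real_inner_comm]
    ring
  add {Z Z'} hZ hZ' := by
    have : CompleteSpace E := FiniteDimensional.complete ℝ E
    simp only [koszul, Pi.add_apply, inner_add_left, map_add, inner_add_right,
      mvfderiv_fun_add (mdifferentiableAt_inner hX hZ) (mdifferentiableAt_inner hX hZ'),
      mvfderiv_fun_add (mdifferentiableAt_inner hY hZ) (mdifferentiableAt_inner hY hZ'),
      mlieBracket_add_right hZ hZ']
    simp
    ring

instance instFiniteDimensionalTangentSpace (x : M) : FiniteDimensional ℝ (TangentSpace I x) :=
  inferInstanceAs (FiniteDimensional ℝ E)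

open scoped Classical in
/-- The linear map `v ↦ ∇_v Y` on the tangent space at `x`, given by the Koszul formula and the
Riesz isomorphism (and `0` if `Y` is not differentiable at `x`). -/
noncomputable def leviCivitaAt (Y : Π x : M, TangentSpace I x) (x : M) :
    TangentSpace I x →L[ℝ] TangentSpace I x :=
  if hY : MDiffAt (T% Y) x then
    LinearMap.toContinuousLinearMap
      { toFun := fun v => (1 / 2 : ℝ) • (InnerProductSpace.toDual ℝ (TangentSpace I x)).symm
          (TensorialAt.mkHom₂ (fun X Z => koszul X Y Z x) x
            (fun Z hZ => koszul_tensorial_left Y Z hY hZ)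
            (fun X hX => koszul_tensorial_right X Y hX hY) v)
        map_add' := fun v w => by simp
        map_smul' := fun c v => by simp [smul_comm c] }
  else 0

theorem inner_leviCivitaAt {X Y Z : Π x : M, TangentSpace I x} {x : M}
    (hX : MDiffAt (T% X) x) (hY : MDiffAt (T% Y) x) (hZ : MDiffAt (T% Z) x) :
    2 * inner ℝ (leviCivitaAt Y x (X x)) (Z x) = koszul X Y Z x := by
  have h := TensorialAt.mkHom₂_apply (fun Z hZ => koszul_tensorial_left Y Z hY hZ)
          (fun X hX => koszul_tensorial_right X Y hX hY) hX hZ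
  rw [leviCivitaAt, dif_pos hY, ← h]
  simp [inner_smul_left]

theorem leviCivitaAt_ext {x : M} {A B : TangentSpace I x →L[ℝ] TangentSpace I x} 
    (h : ∀ X Z : Π x : M, TangentSpace I x, MDiffAt (T% X) x → MDiffAt (T% Z) x →
      inner ℝ (A (X x)) (Z x) = inner ℝ (B (X x)) (Z x)) : A = B := by
  ext v
  refine ext_inner_right ℝ fun w => ?_
  simpa using h (FiberBundle.extend E v) (FiberBundle.extend E w)
    (FiberBundle.mdifferentiableAt_extend ..) (FiberBundle.mdifferentiableAt_extend ..)

variable (I M) in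
/-- The Levi-Civita connection of a Riemannian manifold. In Mathlib's argument order,
`leviCivita I M Y x (X x)` is `(∇_X Y)(x)`. -/
noncomputable def leviCivita :
    CovariantDerivative I E (fun x : M => TangentSpace I x) where
  toFun := leviCivitaAt
  isCovariantDerivativeOnUniv := by
    have : CompleteSpace E := FiniteDimensional.complete ℝ E
    constructor
    · intro Y Y' x hY hY' _
      refine leviCivitaAt_ext fun X Z hX hZ => ?_
      have h1 := inner_leviCivitaAt hX hY hZ
      have h2 := inner_leviCivitaAt hX hY' hZ
      have h3 : 2 * inner ℝ (leviCivitaAt (Y + Y') x (X x)) (Z x) = koszul X (Y + Y') Z x :=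
        inner_leviCivitaAt hX (mdifferentiableAt_add_section hY hY') hZ
      have h4 : koszul X (Y + Y') Z x = koszul X Y Z x + koszul X Y' Z x := by
        simp only [koszul, Pi.add_apply, inner_add_left, map_add, inner_add_right,
          mvfderiv_fun_add (mdifferentiableAt_inner hY hZ) (mdifferentiableAt_inner hY' hZ),
          mvfderiv_fun_add (mdifferentiableAt_inner hX hY) (mdifferentiableAt_inner hX hY'),
          mlieBracket_add_right hY hY', mlieBracket_add_left hY hY']
        simp
        ring
      rw [add_apply, inner_add_left]
      linarith
    · intro Y f x hY hf _
      refine leviCivitaAt_ext fun X Z hX hZ => ?_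
      have h1 := inner_leviCivitaAt hX hY hZ
      have h3 : 2 * inner ℝ (leviCivitaAt (f • Y) x (X x)) (Z x) = koszul X (f • Y) Z x :=
        inner_leviCivitaAt hX (hf.smul_section hY) hZ
      have h4 : koszul X (f • Y) Z x = f x * koszul X Y Z x 
          + 2 * (d% f x (X x) * inner ℝ (Y x) (Z x)) := by
        simp only [koszul, Pi.smul_apply', inner_smul_left, inner_add_left, map_smul, RCLike.conj_to_real,
         mvfderiv_fun_mul hf (mdifferentiableAt_inner hX hY), mvfderiv_fun_mul hf (mdifferentiableAt_inner hY hZ),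
         mlieBracket_smul_right hf hY, mlieBracket_smul_left hf hY, smul_eq_mul, inner_smul_right]
        simp [real_inner_comm]
        ring
      have h5 : inner ℝ ((f x • leviCivitaAt Y x + (d% f x).smulRight (Y x)) (X x)) (Z x)
          = f x * inner ℝ (leviCivitaAt Y x (X x)) (Z x) + d% f x (X x) * inner ℝ (Y x) (Z x) := by
        simp [inner_add_left, inner_smul_left]
      rw [h5]
      linear_combination (h3 + h4 + f x * (-h1)) / 2

/-- The Levi-Civita connection is torsion-free. -/
theorem leviCivita_torsion {X Y : Π x : M, TangentSpace I x} {x : M}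
    (hX : MDiffAt (T% X) x) (hY : MDiffAt (T% Y) x) :
    leviCivita I M Y x (X x) - leviCivita I M X x (Y x) = mlieBracket I X Y x := by
  refine ext_inner_right ℝ fun w => ?_
  obtain ⟨Z, hZ, rfl⟩ : ∃ Z : Π x : M, TangentSpace I x, MDiffAt (T% Z) x ∧ Z x = w :=
    ⟨FiberBundle.extend E w, FiberBundle.mdifferentiableAt_extend .., by simp⟩
  have h1 := inner_leviCivitaAt hX hY hZ
  have h2 := inner_leviCivitaAt hY hX hZ
  have h3 : koszul X Y Z x - koszul Y X Z x = 2 * inner ℝ (mlieBracket I X Y x) (Z x) := by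
    simp only [koszul, mlieBracket_swap_apply (V := Y) (W := X), inner_neg_left,
      fun y => real_inner_comm (X y) (Y y)]
    ring
  rw [inner_sub_left]
  change inner ℝ (leviCivitaAt Y x (X x)) (Z x) - inner ℝ (leviCivitaAt X x (Y x)) (Z x) = _
  linarith

/-- The Levi-Civita connection is metric. -/
theorem leviCivita_metric {X Y Z : Π x : M, TangentSpace I x} {x : M}
    (hX : MDiffAt (T% X) x) (hY : MDiffAt (T% Y) x) (hZ : MDiffAt (T% Z) x) :
    d% (fun y => inner ℝ (Y y) (Z y)) x (X x) =
      inner ℝ (leviCivita I M Y x (X x)) (Z x) + inner ℝ (Y x) (leviCivita I M Z x (X x)) := by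
  have h1 := inner_leviCivitaAt hX hY hZ
  have h2 := inner_leviCivitaAt hX hZ hY
  have h3 : koszul X Y Z x + koszul X Z Y x
      = 2 * d% (fun y => (inner ℝ (Y y) (Z y) : ℝ)) x (X x) := by
    simp only [koszul, mlieBracket_swap_apply (V := Z) (W := Y), inner_neg_left,
      fun y => real_inner_comm (Y y) (Z y)]
    ring
  rw [real_inner_comm (leviCivita I M Z x (X x)) (Y x)]
  change _ = inner ℝ (leviCivitaAt Y x (X x)) (Z x) + inner ℝ (leviCivitaAt Z x (X x)) (Y x)
  linarith

end LeviCivita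
section Submanifold

variable {E : Type*} [NormedAddCommGroup E] [NormedSpace ℝ E] [FiniteDimensional ℝ E]
  {H : Type*} [TopologicalSpace H] {I : ModelWithCorners ℝ E H}
  {M : Type*} [TopologicalSpace M] [ChartedSpace H M] [IsManifold I ∞ M]
  [RiemannianBundle (fun x : M => TangentSpace I x)]
  {E' : Type*} [NormedAddCommGroup E'] [NormedSpace ℝ E'] [FiniteDimensional ℝ E']
  {H' : Type*} [TopologicalSpace H'] {J : ModelWithCorners ℝ E' H'}
  {N : Type*} [TopologicalSpace N] [ChartedSpace H' N] [IsManifold J ∞ N]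
  [RiemannianBundle (fun x : N => TangentSpace J x)]

/-- `φ` is an almost Hermitian structure on the Riemannian manifold `N`: a smooth
`(1,1)`-tensor field with `φ² = -I` and `g(φ·, φ·) = g`. -/
structure IsAlmostHermitian (φ : Π x : N, TangentSpace J x →L[ℝ] TangentSpace J x) : Prop where
  smooth : ContMDiff J (J.prod 𝓘(ℝ, E' →L[ℝ] E')) ∞
    (fun x : N => TotalSpace.mk' (E' →L[ℝ] E')
      (E := fun x : N => TangentSpace J x →L[ℝ] TangentSpace J x) x (φ x))
  sq_eq : ∀ (x : N) (v : TangentSpace J x), φ x (φ x v) = -v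
  inner_eq : ∀ (x : N) (v w : TangentSpace J x),
    (inner ℝ (φ x v) (φ x w) : ℝ) = inner ℝ v w

variable (I J) in
/-- The Riemannian manifold `M` is a submanifold of `N` through the injective smooth immersion `f`,
with the metric induced by `f`. -/
structure IsRiemannianSubmanifold (f : M → N) : Prop where
  smooth : ContMDiff I J ∞ f
  injective : Function.Injective f
  immersion : ∀ p, Function.Injective (mfderiv I J f p)
  induced : ∀ (p : M) (v w : TangentSpace I p),
    (inner ℝ v w : ℝ) = inner ℝ (mfderiv I J f p v) (mfderiv I J f p w)

variable (J) in
/-- The tangential component of a vector of `T_{f p} N`: its orthogonal projection to the image of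
`T_p M`, regarded as an element of `T_p M`. -/
noncomputable def tangentialComponent (f : M → N) (hf : IsRiemannianSubmanifold I J f) (p : M) :
    TangentSpace J (f p) →ₗ[ℝ] TangentSpace I p :=
  (LinearEquiv.ofInjective (mfderiv I J f p).toLinearMap (hf.immersion p)).symm.toLinearMap ∘ₗ
    ((mfderiv I J f p).toLinearMap.range.orthogonalProjectionOnto).toLinearMap

/-- The operator `T`: `T v` is the tangential component of `φ v`, for `v` tangent to `M`. -/
noncomputable def tangentialOperator
    (φ : Π x : N, TangentSpace J x →L[ℝ] TangentSpace J x) {f : M → N}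
    (hf : IsRiemannianSubmanifold I J f) (p : M) : TangentSpace I p →ₗ[ℝ] TangentSpace I p :=
  tangentialComponent J f hf p ∘ₗ (φ (f p)).toLinearMap ∘ₗ (mfderiv I J f p).toLinearMap

/-- A smooth distribution of constant rank: near every point it has a smooth local frame of
`r` vector fields. -/
def IsSmoothRegularDistribution (D : Π p : M, Submodule ℝ (TangentSpace I p)) : Prop :=
  ∃ r : ℕ, ∀ p : M, ∃ U : Set M, IsOpen U ∧ p ∈ U ∧
    ∃ X : Fin r → Π q : M, TangentSpace I q,
      (∀ a, ContMDiffOn I I.tangent ∞ (T% (X a)) U) ∧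
      ∀ q ∈ U, LinearIndependent ℝ (fun a => X a q) ∧
        Submodule.span ℝ (Set.range fun a => X a q) = D q

/-- The angle in `[0, π/2]` between a nonzero vector and a subspace: the angle between the vector
and its orthogonal projection to the subspace (`π/2` if the projection vanishes). -/
noncomputable def angleWithSubspace {V : Type*} [NormedAddCommGroup V] [InnerProductSpace ℝ V]
    (U : Submodule ℝ V) [U.HasOrthogonalProjection] (w : V) : ℝ :=
  InnerProductGeometry.angle w (U.starProjection w)

/-- `D` is a pointwise slant distribution with slant function `θ`: for every nonzero `v ∈ D_p` the
angle between `φ v` and `D_p` (both taken in `T_{f p} N`) is `θ p ≠ 0`. -/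
def HasSlantFunction (φ : Π x : N, TangentSpace J x →L[ℝ] TangentSpace J x) (f : M → N)
    (D : Π p : M, Submodule ℝ (TangentSpace I p)) (θ : M → ℝ) : Prop :=
  ∀ p : M, θ p ≠ 0 ∧ ∀ v ∈ D p, v ≠ 0 →
    angleWithSubspace ((D p).map (mfderiv I J f p).toLinearMap)
      (φ (f p) (mfderiv I J f p v)) = θ p

/-- `M` is a pointwise `k`-slant submanifold with component distributions `D 0, …, D k`; the slant
function of `D (i + 1)` is `θ i`. -/
structure IsPointwiseKSlant
    (φ : Π x : N, TangentSpace J x →L[ℝ] TangentSpace J x) {f : M → N}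
    (hf : IsRiemannianSubmanifold I J f) {k : ℕ}
    (D : Fin (k + 1) → Π p : M, Submodule ℝ (TangentSpace I p)) (θ : Fin k → M → ℝ) : Prop where
  smooth_regular : ∀ i, IsSmoothRegularDistribution (D i)
  orthogonal : ∀ i j, i ≠ j → ∀ p, ∀ v ∈ D i p, ∀ w ∈ D j p, (inner ℝ v w : ℝ) = 0
  iSup_eq_top : ∀ p, ⨆ i, D i p = ⊤
  tangential_mem : ∀ (i : Fin k) p, ∀ v ∈ D i.succ p,
    tangentialOperator φ hf p v ∈ D i.succ p
  invariant : ∀ p, ∀ v ∈ D 0 p, ∃ w ∈ D 0 p,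
    φ (f p) (mfderiv I J f p v) = mfderiv I J f p w
  nontrivial : ∀ (i : Fin k) p, D i.succ p ≠ ⊥
  slant : ∀ i : Fin k, HasSlantFunction φ f (D i.succ) (θ i)
  slant_mem : ∀ (i : Fin k) p, θ i p ∈ Set.Ioc 0 (Real.pi / 2)
  slant_ne : ∀ i j : Fin k, i ≠ j → ∀ p, θ i p ≠ θ j p

/-- A `k`-slant submanifold: a pointwise one whose slant functions are constant. -/
def IsKSlant (φ : Π x : N, TangentSpace J x →L[ℝ] TangentSpace J x) {f : M → N}
    (hf : IsRiemannianSubmanifold I J f) {k : ℕ}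
    (D : Fin (k + 1) → Π p : M, Submodule ℝ (TangentSpace I p)) : Prop :=
  ∃ θ : Fin k → ℝ, IsPointwiseKSlant φ hf D (fun i _ => θ i)

/-- `X` is a smooth vector field on `M` with values in `D`, that is `X ∈ Γ(D)`. -/
def IsSectionOf (D : Π p : M, Submodule ℝ (TangentSpace I p)) (X : Π p : M, TangentSpace I p) :
    Prop :=
  ContMDiff I I.tangent ∞ (T% X) ∧ ∀ p, X p ∈ D p

/-- `[X, Y] ∈ Γ(D)` for all `X, Y ∈ Γ(D)`. The bracket of smooth fields is smooth, so only its
values matter. -/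
def IsIntegrable (D : Π p : M, Submodule ℝ (TangentSpace I p)) : Prop :=
  ∀ X Y : Π p : M, TangentSpace I p, IsSectionOf D X → IsSectionOf D Y →
    ∀ p, mlieBracket I X Y p ∈ D p

variable [IsContMDiffRiemannianBundle I ∞ E (fun x : M => TangentSpace I x)]

/-- `∇_X Y ∈ Γ(D)` for all `X, Y ∈ Γ(D)`, with `∇` the Levi-Civita connection. The field `∇_X Y` is
smooth when `X` and `Y` are, so only its values matter. -/
def IsCompletelyIntegrable (D : Π p : M, Submodule ℝ (TangentSpace I p)) : Prop :=
  ∀ X Y : Π p : M, TangentSpace I p, IsSectionOf D X → IsSectionOf D Y →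
    ∀ p, leviCivita I M Y p (X p) ∈ D p

/-- `((∇_X S) Y)(p) = (∇_X (S Y))(p) - S ((∇_X Y)(p))` for a `(1,1)`-tensor field `S` on `M`. -/
noncomputable def covDerivEndo (S : Π p : M, TangentSpace I p →ₗ[ℝ] TangentSpace I p)
    (X Y : Π p : M, TangentSpace I p) (p : M) : TangentSpace I p :=
  leviCivita I M (fun q => S q (Y q)) p (X p) - S p (leviCivita I M Y p (X p))

end Submanifold

end KSlant

/-! Each component distribution is an eigenspace of $T^2$, with constant eigenvalue. The operator
$T$ is skew because $\varphi$ is. On a slant component it scales norms by $\cos\theta_i$, so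
polarisation and skewness give $T^2=-\cos^2\theta_i$ there; on $\mathcal D_0$, where $T=\varphi$, it
gives $T^2=-1$. Since the angles are distinct and lie in $(0,\pi/2]$, these scalars are distinct,
and because the components span $TM$ each is the whole eigenspace
(`IsPointwiseKSlant.mem_iff_tangentialOperator_sq`).

Let $c$ be the eigenvalue on $\mathcal D_i$ and $Y\in\Gamma(\mathcal D_i)$. Then $T^2Y=cY$, so
$(\nabla_XT^2)Y=(c-T^2)\nabla_XY$, which vanishes exactly when $\nabla_XY$ lies in $\mathcal D_i$.
Antisymmetrising and using zero torsion replaces $\nabla_XY$ by $[X,Y]$, which gives the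
integrability criterion. -/

namespace KSlant

open VectorField

/-! ### Linear algebra of skew operators and orthogonal eigenspaces -/

section LinearAlgebra

variable {V : Type*} [NormedAddCommGroup V] [InnerProductSpace ℝ V]

/-- A skew operator that scales the norm on an invariant subspace by `c` squares to `-c²` there. -/
theorem sq_apply_eq_neg_smul_of_skew {T : V →ₗ[ℝ] V}
    (hT : ∀ v w, (inner ℝ (T v) w : ℝ) = -inner ℝ v (T w)) {D : Submodule ℝ V}
    (hD : ∀ v ∈ D, T v ∈ D) {c : ℝ} (hc : ∀ v ∈ D, ‖T v‖ = c * ‖v‖) {v : V} (hv : v ∈ D) :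
    (T ^ 2) v = -(c ^ 2) • v := by
  have quad : ∀ u ∈ D, (inner ℝ (T u) (T u) : ℝ) = c ^ 2 * inner ℝ u u := fun u hu => by
    rw [real_inner_self_eq_norm_sq, real_inner_self_eq_norm_sq, hc u hu]
    ring
  -- Polarisation of `quad`.
  have polar : ∀ u ∈ D, ∀ w ∈ D, (inner ℝ (T u) (T w) : ℝ) = c ^ 2 * inner ℝ u w :=
    fun u hu w hw => by
      have h := quad (u + w) (D.add_mem hu hw)
      simp only [map_add, inner_add_left, inner_add_right, quad u hu, quad w hw,
        real_inner_comm (T u) (T w), real_inner_comm u w] at h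
      linarith
  -- The vector $T^2v+c^2v$ is orthogonal to $D$ and, by invariance, lies in $D$; hence it is zero.
  have key : ∀ w ∈ D, (inner ℝ (T (T v) + c ^ 2 • v) w : ℝ) = 0 := fun w hw => by
    rw [inner_add_left, real_inner_smul_left, hT (T v) w, polar v hv w hw]
    ring
  have h0 := inner_self_eq_zero.1
    (key _ (D.add_mem (hD _ (hD _ hv)) (D.smul_mem (c ^ 2) hv)))
  rw [pow_two, Module.End.mul_apply, neg_smul]
  exact eq_neg_of_add_eq_zero_left h0

/-- The difference between $w$ and its projection is orthogonal to the range of $A$, so pairing with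
$Av$ does not see it. Afterwards the tangential component can be handled by inner products alone. -/
theorem inner_apply_ofInjective_symm_projection {W : Type*} [NormedAddCommGroup W]
    [InnerProductSpace ℝ W] {A : V →ₗ[ℝ] W} (hA : Function.Injective A)
    [A.range.HasOrthogonalProjection] (w : W) (v : V) :
    (inner ℝ (A ((LinearEquiv.ofInjective A hA).symm (A.range.orthogonalProjectionOnto w)))
      (A v) : ℝ) = inner ℝ w (A v) := by
  have h1 : A ((LinearEquiv.ofInjective A hA).symm (A.range.orthogonalProjectionOnto w)) =
      A.range.starProjection w := by
    rw [← LinearEquiv.ofInjective_apply A (h := hA), LinearEquiv.apply_symm_apply,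
      Submodule.starProjection_apply]
  rw [h1, ← sub_eq_zero, ← inner_sub_left, ← neg_sub, inner_neg_left, neg_eq_zero]
  exact A.range.starProjection_inner_eq_zero w (A v) ⟨v, rfl⟩

/-- If pairwise orthogonal subspaces span and `S` acts on them by distinct scalars, then each of
them is an eigenspace of `S`. -/
theorem mem_iff_apply_eq_smul_of_orthogonal {ι : Type*} [Fintype ι] {D : ι → Submodule ℝ V}
    (orth : ∀ i j, i ≠ j → ∀ v ∈ D i, ∀ w ∈ D j, (inner ℝ v w : ℝ) = 0)
    (htop : ⨆ i, D i = ⊤) {S : V →ₗ[ℝ] V} {μ : ι → ℝ} (hμ : Function.Injective μ)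
    (hS : ∀ i, ∀ v ∈ D i, S v = μ i • v) (i : ι) (w : V) : w ∈ D i ↔ S w = μ i • w := by
  classical
  refine ⟨hS i w, fun hw => ?_⟩
  obtain ⟨u, hu⟩ := (Submodule.mem_iSup_iff_exists_finsupp D w).1 (htop ▸ Submodule.mem_top)
  obtain ⟨hu, rfl⟩ := hu
  rw [Finsupp.sum_fintype _ _ fun _ => rfl] at hw ⊢
  refine Submodule.sum_mem _ fun j _ => ?_
  by_cases hj : j = i
  · exact hj ▸ hu j
  have h1 : ∀ l, l ≠ j → (inner ℝ (u l) (u j) : ℝ) = 0 := fun l hl => orth l j hl _ (hu l) _ (hu j)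
  -- Pairing the eigenvalue equation with $u_j$ isolates $\mu_j|u_j|^2=\mu_i|u_j|^2$, so every
  -- component with $j\ne i$ vanishes.
  have h2 := congrArg (fun x => (inner ℝ x (u j) : ℝ)) hw
  simp only [map_sum, sum_inner, real_inner_smul_left] at h2
  rw [Finset.sum_eq_single j (fun l _ hl => by rw [hS l _ (hu l), real_inner_smul_left, h1 l hl,
    mul_zero]) (by simp), Finset.sum_eq_single j (fun l _ hl => h1 l hl) (by simp),
    hS j _ (hu j), real_inner_smul_left] at h2
  have h3 : (inner ℝ (u j) (u j) : ℝ) = 0 :=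
    (mul_eq_mul_right_iff.1 h2).resolve_left fun h => hj (hμ h)
  rw [inner_self_eq_zero.1 h3]
  exact Submodule.zero_mem _

end LinearAlgebra

/-! ### The operator $T$ and its square on the components -/

section Submanifold

variable {E : Type*} [NormedAddCommGroup E] [NormedSpace ℝ E] [FiniteDimensional ℝ E]
  {H : Type*} [TopologicalSpace H] {I : ModelWithCorners ℝ E H}
  {M : Type*} [TopologicalSpace M] [ChartedSpace H M] [IsManifold I ∞ M]
  [RiemannianBundle (fun x : M => TangentSpace I x)]
  {E' : Type*} [NormedAddCommGroup E'] [NormedSpace ℝ E'] [FiniteDimensional ℝ E']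
  {H' : Type*} [TopologicalSpace H'] {J : ModelWithCorners ℝ E' H'}
  {N : Type*} [TopologicalSpace N] [ChartedSpace H' N] [IsManifold J ∞ N]
  [RiemannianBundle (fun x : N => TangentSpace J x)]
  {φ : Π x : N, TangentSpace J x →L[ℝ] TangentSpace J x} {f : M → N}

theorem inner_tangentialComponent (hf : IsRiemannianSubmanifold I J f) (p : M)
    (w : TangentSpace J (f p)) (v : TangentSpace I p) :
    (inner ℝ (tangentialComponent J f hf p w) v : ℝ) = inner ℝ w (mfderiv I J f p v) := by
  rw [hf.induced]
  exact inner_apply_ofInjective_symm_projection (hf.immersion p) w v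

/-- By nondegeneracy this formula determines $T$; the later facts about $T$ are derived from it. -/
theorem inner_tangentialOperator (hf : IsRiemannianSubmanifold I J f) (p : M)
    (v w : TangentSpace I p) :
    (inner ℝ (tangentialOperator φ hf p v) w : ℝ) =
      inner ℝ (φ (f p) (mfderiv I J f p v)) (mfderiv I J f p w) :=
  inner_tangentialComponent hf p _ w

theorem IsAlmostHermitian.inner_left (hφ : IsAlmostHermitian φ) (x : N) (v w : TangentSpace J x) :
    (inner ℝ (φ x v) w : ℝ) = -inner ℝ v (φ x w) := by
  rw [← hφ.inner_eq x (φ x v) w, hφ.sq_eq, inner_neg_left]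

theorem inner_tangentialOperator_left (hφ : IsAlmostHermitian φ)
    (hf : IsRiemannianSubmanifold I J f) (p : M) (v w : TangentSpace I p) :
    (inner ℝ (tangentialOperator φ hf p v) w : ℝ) =
      -inner ℝ v (tangentialOperator φ hf p w) := by
  rw [real_inner_comm (tangentialOperator φ hf p w) v, inner_tangentialOperator,
    inner_tangentialOperator, hφ.inner_left,
    real_inner_comm (φ (f p) (mfderiv I J f p w)) (mfderiv I J f p v)]

/-- On a slant distribution preserved by `T`, the operator `T` scales the norm by the cosine of the
slant angle. -/
theorem norm_tangentialOperator_of_slant (hφ : IsAlmostHermitian φ)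
    (hf : IsRiemannianSubmanifold I J f) {D : Π p : M, Submodule ℝ (TangentSpace I p)} {θ : M → ℝ}
    (hD : HasSlantFunction φ f D θ) {p : M}
    (hT : ∀ v ∈ D p, tangentialOperator φ hf p v ∈ D p) {v : TangentSpace I p} (hv : v ∈ D p) :
    ‖tangentialOperator φ hf p v‖ = Real.cos (θ p) * ‖v‖ := by
  rcases eq_or_ne v 0 with rfl | hv0
  · simp
  set w := tangentialOperator φ hf p v
  set df := mfderiv I J f p
  -- The slant angle refers to the projection onto the image of $D_p$, whereas $T$ projects onto the
  -- image of the whole tangent space. The two agree because $Tv\in D_p$.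
  have hproj : ((D p).map df.toLinearMap).starProjection (φ (f p) (df v)) = df w := by
    refine Submodule.eq_starProjection_of_mem_of_inner_eq_zero ⟨w, hT v hv, rfl⟩ ?_
    rintro _ ⟨u, -, rfl⟩
    have h := inner_tangentialOperator (φ := φ) hf p v u
    rw [hf.induced] at h
    rw [inner_sub_left]
    exact sub_eq_zero.2 h.symm
  have hangle : InnerProductGeometry.angle (φ (f p) (df v)) (df w) = θ p := by
    rw [← hproj]
    exact (hD p).2 v hv hv0
  have hnorm : ∀ u, ‖df u‖ = ‖u‖ := fun u => by
    rw [norm_eq_sqrt_real_inner, norm_eq_sqrt_real_inner, ← hf.induced]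
  have hnormφ : ‖φ (f p) (df v)‖ = ‖v‖ := by
    rw [← hnorm v, norm_eq_sqrt_real_inner, hφ.inner_eq, ← norm_eq_sqrt_real_inner]
  -- The angle with the zero vector is $\pi/2$ by convention, so $Tv=0$ forces $\cos\theta=0$.
  rcases eq_or_ne w 0 with hw | hw
  · rw [hw, map_zero, InnerProductGeometry.angle_zero_right] at hangle
    rw [hw, ← hangle, Real.cos_pi_div_two, norm_zero, zero_mul]
  -- Here $\cos\theta\,|v|\,|Tv|=g(\varphi v,Tv)=|Tv|^2$, and $|Tv|$ cancels.
  · have h := InnerProductGeometry.cos_angle_mul_norm_mul_norm (φ (f p) (df v)) (df w)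
    rw [hangle, hnormφ, hnorm, ← inner_tangentialOperator hf p v w] at h
    change _ = (inner ℝ w w : ℝ) at h
    rw [real_inner_self_eq_norm_sq] at h
    refine mul_right_cancel₀ (norm_ne_zero_iff.2 hw) ?_
    linarith

/-- As $\varphi v$ is already tangent, the projection leaves it unchanged, so $Tv=w$; then $\varphi
w=\varphi^2v=-v$ is tangent as well. -/
theorem tangentialOperator_sq_of_invariant (hφ : IsAlmostHermitian φ)
    (hf : IsRiemannianSubmanifold I J f) {p : M} {v w : TangentSpace I p}
    (hw : φ (f p) (mfderiv I J f p v) = mfderiv I J f p w) :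
    (tangentialOperator φ hf p ^ 2) v = -v := by
  refine ext_inner_right ℝ fun u => ?_
  have h1 : tangentialOperator φ hf p v = w := ext_inner_right ℝ fun u => by
    rw [inner_tangentialOperator, hw, ← hf.induced]
  rw [pow_two, Module.End.mul_apply, h1, inner_tangentialOperator, ← hw, hφ.sq_eq, inner_neg_left,
    inner_neg_left, ← hf.induced]

/-- The components of a pointwise `k`-slant submanifold are the eigenspaces of `T²`. -/
theorem IsPointwiseKSlant.mem_iff_tangentialOperator_sq (hφ : IsAlmostHermitian φ)
    {hf : IsRiemannianSubmanifold I J f} {k : ℕ}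
    {D : Fin (k + 1) → Π p : M, Submodule ℝ (TangentSpace I p)} {θ : Fin k → M → ℝ}
    (hD : IsPointwiseKSlant φ hf D θ) (i : Fin (k + 1)) (p : M) (v : TangentSpace I p) :
    v ∈ D i p ↔ (tangentialOperator φ hf p ^ 2) v =
      -((Fin.cons 1 fun j => Real.cos (θ j p) ^ 2 : Fin (k + 1) → ℝ) i) • v := by
  refine mem_iff_apply_eq_smul_of_orthogonal (D := fun i => D i p)
    (μ := fun i => -((Fin.cons 1 fun j => Real.cos (θ j p) ^ 2 : Fin (k + 1) → ℝ) i))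
    (fun i j hij => hD.orthogonal i j hij p) (hD.iSup_eq_top p) ?_ ?_ i v
  · have hIcc : ∀ j, θ j p ∈ Set.Icc 0 Real.pi := fun j =>
      ⟨(hD.slant_mem j p).1.le, (hD.slant_mem j p).2.trans (by linarith [Real.pi_pos])⟩
    have hcos : ∀ j, 0 ≤ Real.cos (θ j p) := fun j =>
      Real.cos_nonneg_of_mem_Icc ⟨by linarith [(hD.slant_mem j p).1, Real.pi_pos],
        (hD.slant_mem j p).2⟩
    -- The entry 1 belongs to `D 0`, as if its angle were 0. It differs from the others because
    -- $\theta_j>0$; the others differ among themselves because $\theta_j\le\pi/2$ makes the cosines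
    -- nonnegative, so that their squares determine the angles.
    refine neg_injective.comp (Fin.cons_injective_iff.2 ⟨?_, fun a b hab => ?_⟩)
    · rintro ⟨j, hj⟩
      have h1 : Real.cos (θ j p) = Real.cos 0 := by
        rw [Real.cos_zero, ← pow_left_inj₀ (hcos j) zero_le_one two_ne_zero, one_pow]
        exact hj
      exact (hD.slant_mem j p).1.ne'
        (Real.injOn_cos (hIcc j) ⟨le_rfl, Real.pi_pos.le⟩ h1)
    · by_contra hne
      exact hD.slant_ne a b hne p (Real.injOn_cos (hIcc a) (hIcc b)
        ((pow_left_inj₀ (hcos a) (hcos b) two_ne_zero).1 hab))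
  · intro i
    refine Fin.cases (fun v hv => ?_) (fun j v hv => ?_) i
    · obtain ⟨w, -, hw⟩ := hD.invariant p v hv
      simpa using tangentialOperator_sq_of_invariant hφ hf hw
    · exact sq_apply_eq_neg_smul_of_skew (inner_tangentialOperator_left hφ hf p)
        (hD.tangential_mem j p)
        (fun u hu => norm_tangentialOperator_of_slant hφ hf (hD.slant j)
          (hD.tangential_mem j p) hu) hv

/-! ### Covariant derivative of an endomorphism on a constant eigendistribution -/

variable [IsContMDiffRiemannianBundle I ∞ E (fun x : M => TangentSpace I x)]

/-- This is where constancy of the slant angles matters: a nonconstant factor $c$ would contribute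
the extra term $dc(v)\,Y$. -/
theorem leviCivita_const_smul {Y : Π x : M, TangentSpace I x} {x : M} (hY : MDiffAt (T% Y) x)
    (c : ℝ) (v : TangentSpace I x) :
    leviCivita I M (fun y => c • Y y) x v = c • leviCivita I M Y x v := by
  exact congrArg (fun A => A v) ((leviCivita I M).isCovariantDerivativeOnUniv.smul_const c hY)

/-- If `S` acts on `D` by the constant `c`, then `(∇_X S) Y = c ∇_X Y - S (∇_X Y)` for `Y ∈ Γ(D)`. -/
theorem covDerivEndo_eq_of_isSectionOf {D : Π p : M, Submodule ℝ (TangentSpace I p)}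
    {S : Π p : M, TangentSpace I p →ₗ[ℝ] TangentSpace I p} {c : ℝ}
    (hS : ∀ p, ∀ v ∈ D p, S p v = c • v) (X : Π p : M, TangentSpace I p)
    {Y : Π p : M, TangentSpace I p} (hY : IsSectionOf D Y) (p : M) :
    covDerivEndo S X Y p =
      c • leviCivita I M Y p (X p) - S p (leviCivita I M Y p (X p)) := by
  rw [covDerivEndo, funext fun q => hS q _ (hY.2 q),
    leviCivita_const_smul ((hY.1 p).mdifferentiableAt (by simp))]

/-- If `D` is a constant eigendistribution of `S`, it is completely integrable if and only if
`(∇_X S) Y = 0` on `Γ(D)`. -/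
theorem isCompletelyIntegrable_iff_covDerivEndo {D : Π p : M, Submodule ℝ (TangentSpace I p)}
    {S : Π p : M, TangentSpace I p →ₗ[ℝ] TangentSpace I p} {c : ℝ}
    (hS : ∀ p v, v ∈ D p ↔ S p v = c • v) :
    IsCompletelyIntegrable D ↔ ∀ X Y : Π p : M, TangentSpace I p,
      IsSectionOf D X → IsSectionOf D Y → ∀ p, covDerivEndo S X Y p = 0 := by
  refine forall₅_congr fun X Y _ hY p => ?_
  rw [covDerivEndo_eq_of_isSectionOf (fun p v => (hS p v).1) X hY, hS, sub_eq_zero, eq_comm]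

/-- If `D` is a constant eigendistribution of `S`, it is integrable if and only if
`(∇_X S) Y = (∇_Y S) X` on `Γ(D)`. -/
theorem isIntegrable_iff_covDerivEndo {D : Π p : M, Submodule ℝ (TangentSpace I p)}
    {S : Π p : M, TangentSpace I p →ₗ[ℝ] TangentSpace I p} {c : ℝ}
    (hS : ∀ p v, v ∈ D p ↔ S p v = c • v) :
    IsIntegrable D ↔ ∀ X Y : Π p : M, TangentSpace I p,
      IsSectionOf D X → IsSectionOf D Y → ∀ p, covDerivEndo S X Y p = covDerivEndo S Y X p := by
  refine forall₅_congr fun X Y hX hY p => ?_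
  rw [covDerivEndo_eq_of_isSectionOf (fun p v => (hS p v).1) X hY,
    covDerivEndo_eq_of_isSectionOf (fun p v => (hS p v).1) Y hX, hS,
    ← leviCivita_torsion ((hX.1 p).mdifferentiableAt (by simp))
      ((hY.1 p).mdifferentiableAt (by simp)), map_sub, smul_sub, sub_eq_sub_iff_sub_eq_sub]
  -- With all terms on one side, the two equations are negatives of each other.
  constructor <;> intro h
  · rw [← sub_eq_zero] at h ⊢
    rw [← neg_eq_zero, ← h]
    abel
  · rw [← sub_eq_zero] at h ⊢
    rw [← neg_eq_zero, ← h]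
    abel

end Submanifold

end KSlant

theorem corollary3p8
    {E : Type*} [NormedAddCommGroup E] [NormedSpace ℝ E] [FiniteDimensional ℝ E]
    {M : Type*} [TopologicalSpace M] [ChartedSpace E M] [IsManifold 𝓘(ℝ, E) ∞ M]
    [RiemannianBundle (fun x : M => TangentSpace 𝓘(ℝ, E) x)]
    [IsContMDiffRiemannianBundle 𝓘(ℝ, E) ∞ E (fun x : M => TangentSpace 𝓘(ℝ, E) x)]
    {E' : Type*} [NormedAddCommGroup E'] [NormedSpace ℝ E'] [FiniteDimensional ℝ E']
    {N : Type*} [TopologicalSpace N] [ChartedSpace E' N] [IsManifold 𝓘(ℝ, E') ∞ N]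
    [RiemannianBundle (fun x : N => TangentSpace 𝓘(ℝ, E') x)]
    [IsContMDiffRiemannianBundle 𝓘(ℝ, E') ∞ E' (fun x : N => TangentSpace 𝓘(ℝ, E') x)]
    (φ : Π x : N, TangentSpace 𝓘(ℝ, E') x →L[ℝ] TangentSpace 𝓘(ℝ, E') x)
    (hφ : KSlant.IsAlmostHermitian φ)
    (f : M → N) (hf : KSlant.IsRiemannianSubmanifold 𝓘(ℝ, E) 𝓘(ℝ, E') f)
    (k : ℕ) (hk : 1 ≤ k)
    (D : Fin (k + 1) → Π p : M, Submodule ℝ (TangentSpace 𝓘(ℝ, E) p))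
    (hD : KSlant.IsKSlant φ hf D) (i : Fin (k + 1)) :
    (KSlant.IsCompletelyIntegrable (D i) ↔
      ∀ X Y : Π p : M, TangentSpace 𝓘(ℝ, E) p,
        KSlant.IsSectionOf (D i) X → KSlant.IsSectionOf (D i) Y →
        ∀ p, KSlant.covDerivEndo (fun q => KSlant.tangentialOperator φ hf q ^ 2) X Y p = 0) ∧
    (KSlant.IsIntegrable (D i) ↔
      ∀ X Y : Π p : M, TangentSpace 𝓘(ℝ, E) p,
        KSlant.IsSectionOf (D i) X → KSlant.IsSectionOf (D i) Y →
        ∀ p, KSlant.covDerivEndo (fun q => KSlant.tangentialOperator φ hf q ^ 2) X Y p =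
          KSlant.covDerivEndo (fun q => KSlant.tangentialOperator φ hf q ^ 2) Y X p) := by
  obtain ⟨θ, hθ⟩ := hD
  -- The slant functions are constant, so the eigenvalue is independent of $p$ and serves as `c`.
  exact ⟨KSlant.isCompletelyIntegrable_iff_covDerivEndo
      fun p v => hθ.mem_iff_tangentialOperator_sq hφ i p v,
    KSlant.isIntegrable_iff_covDerivEndo fun p v => hθ.mem_iff_tangentialOperator_sq hφ i p v⟩
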